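/- Let $\mathcal{H}$ be a finite dimensional real or complex inner product space, $A:\mathcal{H}\to\mathcal{H}$ a linear Hermitian operator, and $\mathcal{X},\mathcal{Y}\subseteq\mathcal{H}$ subspaces with $\dim\mathcal{X}\le\dim\mathcal{Y}$. Notation. $P_{\mathcal{W}}$ is the orthogonal projector onto a subspace $\mathcal{W}$. $\Lambda(B)$ is the vector of eigenvalues of a Hermitian operator $B$, listed with multiplicity in decreasing order. $\Lambda_{\dim\mathcal{X}}\left((P_{\mathcal{Y}}A)|_{\mathcal{Y}}\right)$ is the vector of the $\dim\mathcal{X}$ largest eigenvalues of $(P_{\mathcal{Y}}A)|_{\mathcal{Y}}$ in decreasing order, and $\lambda_{\min(\mathcal{X}+\mathcal{Y})}$ is the smallest eigenvalue of $(P_{\mathcal{X}+\mathcal{Y}}A)|_{\mathcal{X}+\mathcal{Y}}$. The vector $\Theta(\mathcal{X},\mathcal{Y})$ of the $\dim\mathcal{X}$ principal angles from $\mathcal{X}$ to $\mathcal{Y}$ has decreasing entries in $[0,\pi/2]$ and is defined by letting $\cos^2\Theta(\mathcal{X},\mathcal{Y})$ be the vector of eigenvalues of $(P_{\mathcal{X}}P_{\mathcal{Y}})|_{\mathcal{X}}$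 in increasing order. For $x,y\in\mathbb{R}^n$, $x\prec_w y$ means that $\sum_{i=1}^k x_i^{\downarrow}\le\sum_{i=1}^k y_i^{\downarrow}$ for $k=1,\dots,n$, where $\downarrow$ denotes decreasing rearrangement. Operations, functions and inequalities ($\le$, $<$) of vectors are meant entrywise, with scalars standing for constant vectors. Theorem. Assume that $\mathcal{X}$ is $A$-invariant and corresponds to the contiguous set of the largest eigenvalues of $A$, i.e., $\Lambda\left((P_{\mathcal{X}}A)|_{\mathcal{X}}\right)$ consists of the $\dim\mathcal{X}$ largest eigenvalues of $A$, counted with multiplicity. Then $$0\le\Lambda\left((P_{\mathcal{X}}A)|_{\mathcal{X}}\right)-\Lambda_{\dim\mathcal{X}}\left((P_{\mathcal{Y}}A)|_{\mathcal{Y}}\right)\prec_w\left(\Lambda\left((P_{\mathcal{X}}A)|_{\mathcal{X}}\right)-\lambda_{\min(\mathcal{X}+\mathcal{Y})}\right)\sin^2\Theta(\mathcal{X},\mathcal{Y}).$$ If in addition $\Theta(\mathcal{X},\mathcal{Y})<\pi/2$ and $\Lambda\left((P_{\mathcal{X}}A)|_{\mathcal{X}}\right)>\lambda_{\min(\mathcal{X}+\mathcal{Y})}$,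 then $\Lambda_{\dim\mathcal{X}}\left((P_{\mathcal{Y}}A)|_{\mathcal{Y}}\right)>\lambda_{\min(\mathcal{X}+\mathcal{Y})}$, $$0\le\log\frac{\Lambda\left((P_{\mathcal{X}}A)|_{\mathcal{X}}\right)-\lambda_{\min(\mathcal{X}+\mathcal{Y})}}{\Lambda_{\dim\mathcal{X}}\left((P_{\mathcal{Y}}A)|_{\mathcal{Y}}\right)-\lambda_{\min(\mathcal{X}+\mathcal{Y})}}\prec_w\log\left(1+\tan^2\Theta(\mathcal{X},\mathcal{Y})\right),$$ and $$0\le\frac{\Lambda\left((P_{\mathcal{X}}A)|_{\mathcal{X}}\right)-\Lambda_{\dim\mathcal{X}}\left((P_{\mathcal{Y}}A)|_{\mathcal{Y}}\right)}{\Lambda_{\dim\mathcal{X}}\left((P_{\mathcal{Y}}A)|_{\mathcal{Y}}\right)-\lambda_{\min(\mathcal{X}+\mathcal{Y})}}\prec_w\tan^2\Theta(\mathcal{X},\mathcal{Y}).$$ -/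

import Mathlib

noncomputable section

namespace RayleighRitz

open Module

/-- The vector `x` rearranged so that its entries decrease. -/
def decreasing {n : ℕ} (x : Fin n → ℝ) : Fin n → ℝ :=
  fun i => x (Tuple.sort x (Fin.rev i))

theorem decreasing_antitone {n : ℕ} (x : Fin n → ℝ) : Antitone (decreasing x) := by
  intro i j h
  exact Tuple.monotone_sort x (Fin.rev_le_rev.mpr h)

/-- Weak (sub-)majorization `x ≺_w y`: for `k = 1, …, n`, the sum of the `k` largest entries of `x`
is at most the sum of the `k` largest entries of `y`. -/
def WeaklyMajorizedBy {n : ℕ} (x y : Fin n → ℝ) : Prop :=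
  ∀ k : ℕ, 1 ≤ k → k ≤ n →
    ∑ i : Fin n with i.val < k, decreasing x i ≤ ∑ i : Fin n with i.val < k, decreasing y i

variable {𝕜 H : Type*} [RCLike 𝕜] [NormedAddCommGroup H] [InnerProductSpace 𝕜 H]
  [FiniteDimensional 𝕜 H]

/-- The Rayleigh-Ritz operator `(P_W A)|_W : W → W`, where `P_W` is the orthogonal projector
onto `W`. -/
def ritzOperator (A : H →ₗ[𝕜] H) (W : Submodule 𝕜 H) : W →ₗ[𝕜] W :=
  (W.orthogonalProjectionOnto : H →ₗ[𝕜] W) ∘ₗ A ∘ₗ W.subtype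

theorem ritzOperator_isSymmetric {A : H →ₗ[𝕜] H} (hA : A.IsSymmetric) (W : Submodule 𝕜 H) :
    (ritzOperator A W).IsSymmetric := by
  intro x y
  simp only [ritzOperator, LinearMap.comp_apply, Submodule.subtype_apply,
    ContinuousLinearMap.coe_coe, Submodule.inner_orthogonalProjectionOnto_eq_of_mem_right,
    Submodule.inner_orthogonalProjectionOnto_eq_of_mem_left]
  exact hA x y

/-- The Ritz values `Λ((P_W A)|_W)` of the Hermitian operator `A` on the trial subspace `W`:
the eigenvalues of the Rayleigh-Ritz operator, counted with multiplicity, in decreasing order. -/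
def ritzValues {A : H →ₗ[𝕜] H} (hA : A.IsSymmetric) (W : Submodule 𝕜 H) :
    Fin (finrank 𝕜 W) → ℝ :=
  (ritzOperator_isSymmetric hA W).eigenvalues rfl

/-- The smallest Ritz value of `A` on the trial subspace `W` (meaningful if `W` is nontrivial). -/
def minRitzValue {A : H →ₗ[𝕜] H} (hA : A.IsSymmetric) (W : Submodule 𝕜 H) : ℝ :=
  ⨅ i, ritzValues hA W i

/-- `cos² Θ(X, Y)`: the eigenvalues of `(P_X P_Y)|_X`, counted with multiplicity, in increasing
order. -/
def cosSqAngles (X Y : Submodule 𝕜 H) : Fin (finrank 𝕜 X) → ℝ :=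
  fun i => ritzValues Y.starProjection_isSymmetric X (Fin.rev i)

/-- The vector `Θ(X, Y)` of the principal angles in `[0, π/2]` from `X` to `Y`, in decreasing
order. -/
def angles (X Y : Submodule 𝕜 H) : Fin (finrank 𝕜 X) → ℝ :=
  fun i => Real.arccos (Real.sqrt (cosSqAngles X Y i))

/-- `X` is `A`-invariant and corresponds to the contiguous set of the largest eigenvalues of `A`:
the eigenvalues of `A` on `X` are the `dim X` largest eigenvalues of `A`, counted with
multiplicity. -/
def IsTopInvariant {A : H →ₗ[𝕜] H} (hA : A.IsSymmetric) (X : Submodule 𝕜 H) : Prop :=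
  (∀ x ∈ X, A x ∈ X) ∧
    ∀ i : Fin (finrank 𝕜 X),
      ritzValues hA X i = hA.eigenvalues rfl (Fin.castLE (Submodule.finrank_le X) i)

/-- The `dim X` largest Ritz values of `A` on the trial subspace `Y`, in decreasing order. -/
def largestRitzValues {A : H →ₗ[𝕜] H} (hA : A.IsSymmetric) (X Y : Submodule 𝕜 H)
    (h : finrank 𝕜 X ≤ finrank 𝕜 Y) : Fin (finrank 𝕜 X) → ℝ :=
  fun i => ritzValues hA Y (Fin.castLE h i)

end RayleighRitz

end

/-!
Let `c` be the smallest Ritz value on `X + Y`, let `d` be the decreasing vector of the eigenvalues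
of `D = (A - c)|_X`, and let `g` be the increasing vector of the eigenvalues `cos² Θ` of
`G = (P_X P_Y)|_X`. The operator `A - c` is positive on `X + Y` and `X` is invariant, so for
`w ∈ Y` its quadratic form at `w` is at least its form at `P_X w`. A max–min argument then shows
that the Ritz values `β` on `Y` satisfy `β i - c ≥ γ i`, where `γ` are the eigenvalues of
`D^{1/2} G D^{1/2}` (`sandwichEigenvalues_le_ritzValues_sub`). The theorem thus reduces to an
additive and a multiplicative inequality of Lidskii type, comparing `γ` with `d` through `g`.

Both come from one truncation, in the spirit of Li and Mathias. For a set `I` of `k` indices put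
`t = g (k - 1)`, the `k`-th smallest eigenvalue of `G`, and let `z` be the eigenvalues of
`D^{1/2} min(G, t) D^{1/2}`. Then `z i ≤ γ i` and `z i ≤ t * d i`. By the second inequality, the
gaps between `z` and `t * d` (as differences or as ratios) over `I` amount to at most the gaps over
all indices, and those are a trace or a determinant. The trace is bounded by rearrangement
(`sum_sub_sandwichEigenvalues_le`), and the determinant is `det D` times the `k` smallest entries
of `g` and a power of `t` (`sum_log_div_sandwichEigenvalues_le`).

The bound with `tan² Θ` follows from the logarithmic one, as weak majorization is preserved by
`t ↦ exp t - 1` (`WeaklyMajorizedBy.exp_sub_one`). The inequalities `0 ≤ …` are Cauchy interlacing.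
-/

noncomputable section

namespace RayleighRitz

open Module

/-! ### Weighted sums of decreasing vectors -/

theorem card_filter_val_lt {n k : ℕ} (hk : k ≤ n) :
    (Finset.univ.filter fun i : Fin n => i.val < k).card = k := by
  rw [Fin.card_filter_val_lt]
  exact min_eq_right hk

theorem sum_mul_le_sum_filter_of_antitone {n k : ℕ} (hk : k ≤ n) {z w : Fin n → ℝ}
    (hz : Antitone z) (hw0 : ∀ i, 0 ≤ w i) (hw1 : ∀ i, w i ≤ 1) (hw : ∑ i, w i = k) :
    ∑ i, z i * w i ≤ ∑ i : Fin n with i.val < k, z i := by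
  rcases Nat.eq_zero_or_pos k with rfl | hpos
  · have h0 : ∀ i, w i = 0 := by
      have := (Finset.sum_eq_zero_iff_of_nonneg (fun i _ => hw0 i)).1 (by simpa using hw)
      intro i
      exact this i (Finset.mem_univ i)
    simp [h0]
  · set c := z ⟨k - 1, by omega⟩ with hc
    have h1 : ∑ i, (z i - c) * w i ≤ ∑ i : Fin n, if i.val < k then z i - c else 0 := by
      refine Finset.sum_le_sum fun i _ => ?_
      split_ifs with hi
      · have : c ≤ z i := hz (by rw [Fin.le_def]; simp; omega)
        nlinarith [hw0 i, hw1 i]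
      · have : z i ≤ c := hz (by rw [Fin.le_def]; simp; omega)
        nlinarith [hw0 i, hw1 i]
    rw [← Finset.sum_filter, Finset.sum_sub_distrib, Finset.sum_const, card_filter_val_lt hk] at h1
    simp only [sub_mul, Finset.sum_sub_distrib, ← Finset.mul_sum, hw, nsmul_eq_mul] at h1
    linarith

theorem sum_le_sum_filter_of_antitone {n : ℕ} {z : Fin n → ℝ} (hz : Antitone z)
    (I : Finset (Fin n)) : ∑ i ∈ I, z i ≤ ∑ i : Fin n with i.val < I.card, z i := by
  have := sum_mul_le_sum_filter_of_antitone (k := I.card) (by simpa using I.card_le_univ) hz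
    (w := fun i => if i ∈ I then 1 else 0) (fun i => by positivity)
    (fun i => by split_ifs <;> norm_num) (by simp)
  simpa using this

/-- Summation by parts: decreasing nonnegative weights preserve nonnegativity of all partial
sums. -/
theorem sum_mul_nonneg_of_partial_sums_nonneg {n : ℕ} {w a : Fin n → ℝ} (hw : Antitone w)
    (hw0 : ∀ i, 0 ≤ w i) (ha : ∀ k ≤ n, 0 ≤ ∑ i : Fin n with i.val < k, a i) :
    0 ≤ ∑ i, w i * a i := by
  induction n with
  | zero => simp
  | succ n ih =>
    have h := ih (w := fun i => w i.castSucc - w (Fin.last n)) (a := fun i => a i.castSucc)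
      (fun i j hij => sub_le_sub_right (hw (Fin.castSucc_le_castSucc_iff.2 hij)) _)
      (fun i => sub_nonneg.2 (hw (Fin.le_last _)))
      (fun k hk => by
        have := ha k (by omega)
        rw [Finset.sum_filter, Fin.sum_univ_castSucc] at this
        rw [Finset.sum_filter]
        simpa [not_lt.2 hk] using this)
    have htot : 0 ≤ ∑ i, a i := by
      have := ha (n + 1) le_rfl
      rwa [Finset.filter_true_of_mem (fun i _ => i.is_lt)] at this
    have h2 := mul_nonneg (hw0 (Fin.last n)) htot
    rw [Fin.sum_univ_castSucc] at h2 ⊢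
    simp only [sub_mul, Finset.sum_sub_distrib, ← Finset.mul_sum] at h
    linarith

/-- Rearrangement inequality averaged over a doubly stochastic matrix. -/
theorem sum_sum_mul_mul_le_of_doublyStochastic {n : ℕ} {d s : Fin n → ℝ} {p : Fin n → Fin n → ℝ}
    (hd : Antitone d) (hs : Antitone s) (hs0 : ∀ i, 0 ≤ s i) (hp : ∀ i j, 0 ≤ p i j)
    (hrow : ∀ i, ∑ j, p i j = 1) (hcol : ∀ j, ∑ i, p i j = 1) :
    ∑ i, ∑ j, d i * s j * p i j ≤ ∑ j, d j * s j := by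
  have h := sum_mul_nonneg_of_partial_sums_nonneg (a := fun j => d j - ∑ i, d i * p i j) hs hs0
    (fun k hk => by
      have := sum_mul_le_sum_filter_of_antitone hk hd
        (w := fun i => ∑ j : Fin n with j.val < k, p i j)
        (fun i => Finset.sum_nonneg fun j _ => hp i j)
        (fun i => (Finset.sum_le_sum_of_subset_of_nonneg (Finset.filter_subset _ _)
          (fun j _ _ => hp i j)).trans (hrow i).le)
        (by rw [Finset.sum_comm]; simp [hcol, card_filter_val_lt hk])
      simp only [Finset.mul_sum] at this
      rw [Finset.sum_comm] at this
      rw [Finset.sum_sub_distrib]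
      linarith)
  rw [Finset.sum_comm]
  simp only [mul_sub, Finset.sum_sub_distrib, Finset.mul_sum] at h
  have e1 : ∑ j, s j * d j = ∑ j, d j * s j := Finset.sum_congr rfl fun _ _ => mul_comm _ _
  have e2 : ∑ j, ∑ i, s j * (d i * p i j) = ∑ j, ∑ i, d i * s j * p i j :=
    Finset.sum_congr rfl fun _ _ => Finset.sum_congr rfl fun _ _ => by ring
  linarith

/-! ### Weak majorization -/

/-- A sum of `k` entries is at most the sum of the `k` largest entries. -/
theorem sum_le_sum_decreasing {n : ℕ} (y : Fin n → ℝ) (I : Finset (Fin n)) :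
    ∑ i ∈ I, y i ≤ ∑ i : Fin n with i.val < I.card, decreasing y i := by
  let e : Fin n ≃ Fin n := Fin.revPerm.trans (Tuple.sort y)
  have h := sum_le_sum_filter_of_antitone (decreasing_antitone y) (I.map e.symm.toEmbedding)
  rw [Finset.card_map, Finset.sum_map] at h
  refine le_trans (le_of_eq (Finset.sum_congr rfl fun i _ => ?_)) h
  have : e (e.symm i) = i := e.apply_symm_apply i
  exact congrArg y this.symm

/-- To bound `x` it is enough to bound every sum of `k` entries of `x` by the sum of the first `k`
entries of `y`; the latter need not be sorted. -/
theorem WeaklyMajorizedBy.of_forall_finset {n : ℕ} {x y : Fin n → ℝ}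
    (h : ∀ I : Finset (Fin n), I.Nonempty →
      ∑ i ∈ I, x i ≤ ∑ i : Fin n with i.val < I.card, y i) :
    WeaklyMajorizedBy x y := by
  intro k hk1 hk
  let e : Fin n ≃ Fin n := Fin.revPerm.trans (Tuple.sort x)
  set K := Finset.univ.filter fun i : Fin n => i.val < k
  have hK : K.card = k := card_filter_val_lt hk
  have h1 := h (K.map e.toEmbedding) (by
    rw [Finset.map_nonempty, ← Finset.card_pos]; omega)
  rw [Finset.card_map, Finset.sum_map, hK] at h1
  have h2 := sum_le_sum_decreasing y K
  rw [hK] at h2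
  exact h1.trans h2

theorem decreasing_comp {n : ℕ} {f : ℝ → ℝ} (hf : Monotone f) (x : Fin n → ℝ) :
    decreasing (fun i => f (x i)) = fun i => f (decreasing x i) := by
  funext i
  have h : (f ∘ x) ∘ Tuple.sort x = (f ∘ x) ∘ Tuple.sort (f ∘ x) :=
    Tuple.comp_sort_eq_comp_iff_monotone.2 (hf.comp (Tuple.monotone_sort x))
  exact (congrFun h (Fin.rev i)).symm

/-- Weak majorization is preserved by the increasing convex function `t ↦ exp t - 1`: the tangent
lines at the sorted entries of `x` have decreasing positive slopes. -/
theorem WeaklyMajorizedBy.exp_sub_one {n : ℕ} {x y : Fin n → ℝ} (h : WeaklyMajorizedBy x y) :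
    WeaklyMajorizedBy (fun i => Real.exp (x i) - 1) (fun i => Real.exp (y i) - 1) := by
  intro k hk1 hk
  have hf : Monotone fun t : ℝ => Real.exp t - 1 := fun a b hab =>
    sub_le_sub_right (Real.exp_le_exp.2 hab) 1
  rw [decreasing_comp hf, decreasing_comp hf]
  set X := decreasing x with hX
  set Y := decreasing y with hY
  have h0 := sum_mul_nonneg_of_partial_sums_nonneg (w := fun i => Real.exp (X i))
    (a := fun i => if i.val < k then Y i - X i else 0)
    (fun i j hij => Real.exp_le_exp.2 (decreasing_antitone x hij)) (fun i => (Real.exp_pos _).le)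
    (fun m hm => by
      have hmin : ∀ a : ℕ, a ≤ n → 0 ≤ ∑ i : Fin n with i.val < a, (Y i - X i) := by
        intro a ha
        rcases Nat.eq_zero_or_pos a with rfl | hpos
        · simp
        · rw [Finset.sum_sub_distrib]; exact sub_nonneg.2 (h a hpos ha)
      have := hmin (min m k) (by omega)
      rw [← Finset.sum_filter, Finset.filter_filter]
      simpa only [lt_min_iff] using this)
  rw [← sub_nonneg, ← Finset.sum_sub_distrib]
  simp only [mul_ite, mul_zero] at h0
  rw [← Finset.sum_filter] at h0
  refine h0.trans (Finset.sum_le_sum fun i _ => ?_)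
  have h1 := Real.add_one_le_exp (Y i - X i)
  have h2 : Real.exp (Y i) = Real.exp (X i) * Real.exp (Y i - X i) := by
    rw [← Real.exp_add]; ring_nf
  nlinarith [Real.exp_pos (X i)]

/-! ### Quadratic forms in orthonormal bases -/

section Operators

variable {𝕜 E : Type*} [RCLike 𝕜] [NormedAddCommGroup E] [InnerProductSpace 𝕜 E] {n : ℕ}

/-- The operator that multiplies the `i`-th vector of the orthonormal basis `b` by the real number
`f i`. -/
def diagOp (b : OrthonormalBasis (Fin n) 𝕜 E) (f : Fin n → ℝ) : E →ₗ[𝕜] E :=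
  b.toBasis.constr 𝕜 fun i => (f i : 𝕜) • b i

@[simp]
theorem diagOp_basis (b : OrthonormalBasis (Fin n) 𝕜 E) (f : Fin n → ℝ) (i : Fin n) :
    diagOp b f (b i) = (f i : 𝕜) • b i := by
  rw [diagOp, ← b.coe_toBasis, Basis.constr_basis]

theorem inner_basis_diagOp (b : OrthonormalBasis (Fin n) 𝕜 E) (f : Fin n → ℝ) (i : Fin n) (v : E) :
    inner 𝕜 (b i) (diagOp b f v) = (f i : 𝕜) * inner 𝕜 (b i) v := by
  conv_lhs => rw [← b.sum_repr' v]
  simp only [map_sum, map_smul, diagOp_basis, inner_sum, inner_smul_right,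
    OrthonormalBasis.inner_eq_ite]
  simp [mul_comm]

theorem diagOp_isSymmetric (b : OrthonormalBasis (Fin n) 𝕜 E) (f : Fin n → ℝ) :
    (diagOp b f).IsSymmetric := by
  intro x y
  rw [← b.sum_inner_mul_inner, ← b.sum_inner_mul_inner]
  refine Finset.sum_congr rfl fun i _ => ?_
  rw [inner_basis_diagOp, ← inner_conj_symm (diagOp b f x), inner_basis_diagOp]
  simp only [map_mul, RCLike.conj_ofReal, inner_conj_symm]
  ring

theorem re_inner_diagOp (b : OrthonormalBasis (Fin n) 𝕜 E) (f : Fin n → ℝ) (v : E) :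
    RCLike.re (inner 𝕜 (diagOp b f v) v) = ∑ i, f i * ‖inner 𝕜 (b i) v‖ ^ 2 := by
  rw [← b.sum_inner_mul_inner, map_sum]
  refine Finset.sum_congr rfl fun i _ => ?_
  rw [← inner_conj_symm (diagOp b f v), inner_basis_diagOp, map_mul (starRingEnd 𝕜),
    RCLike.conj_ofReal, mul_assoc, RCLike.conj_mul, ← RCLike.ofReal_pow,
    ← RCLike.ofReal_mul, RCLike.ofReal_re]

theorem diagOp_le_diagOp (b : OrthonormalBasis (Fin n) 𝕜 E) {f g : Fin n → ℝ} (h : ∀ i, f i ≤ g i)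
    (v : E) :
    RCLike.re (inner 𝕜 (diagOp b f v) v) ≤ RCLike.re (inner 𝕜 (diagOp b g v) v) := by
  rw [re_inner_diagOp, re_inner_diagOp]
  exact Finset.sum_le_sum fun i _ => mul_le_mul_of_nonneg_right (h i) (sq_nonneg _)

theorem diagOp_le_const (b : OrthonormalBasis (Fin n) 𝕜 E) {f : Fin n → ℝ} {c : ℝ}
    (h : ∀ i, f i ≤ c) (v : E) :
    RCLike.re (inner 𝕜 (diagOp b f v) v) ≤ c * ‖v‖ ^ 2 := by
  rw [re_inner_diagOp, ← b.sum_sq_norm_inner_right, Finset.mul_sum]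
  exact Finset.sum_le_sum fun i _ => mul_le_mul_of_nonneg_right (h i) (sq_nonneg _)

theorem const_le_diagOp (b : OrthonormalBasis (Fin n) 𝕜 E) {f : Fin n → ℝ} {c : ℝ}
    (h : ∀ i, c ≤ f i) (v : E) :
    c * ‖v‖ ^ 2 ≤ RCLike.re (inner 𝕜 (diagOp b f v) v) := by
  rw [re_inner_diagOp, ← b.sum_sq_norm_inner_right, Finset.mul_sum]
  exact Finset.sum_le_sum fun i _ => mul_le_mul_of_nonneg_right (h i) (sq_nonneg _)

theorem det_diagOp (b : OrthonormalBasis (Fin n) 𝕜 E) (f : Fin n → ℝ) :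
    LinearMap.det (diagOp b f) = ((∏ i, f i : ℝ) : 𝕜) := by
  have h : LinearMap.toMatrix b.toBasis b.toBasis (diagOp b f)
      = Matrix.diagonal fun i => (f i : 𝕜) := by
    ext i j
    rw [LinearMap.toMatrix_apply, b.coe_toBasis, b.coe_toBasis_repr_apply, b.repr_apply_apply,
      inner_basis_diagOp, OrthonormalBasis.inner_eq_ite, Matrix.diagonal_apply]
    split_ifs <;> simp
  rw [← LinearMap.det_toMatrix b.toBasis, h, Matrix.det_diagonal]
  simp

/-! ### The Courant–Fischer principle -/

theorem finrank_span_image (b : OrthonormalBasis (Fin n) 𝕜 E) (s : Finset (Fin n)) :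
    finrank 𝕜 (Submodule.span 𝕜 (b '' (s : Set (Fin n)))) = s.card := by
  have hli : LinearIndependent 𝕜 (fun i : s => b i) :=
    b.orthonormal.linearIndependent.comp _ Subtype.val_injective
  have := finrank_span_eq_card hli
  rw [Fintype.card_coe] at this
  rw [← this, Set.image_eq_range]
  rfl

theorem inner_eq_zero_of_mem_span_image (b : OrthonormalBasis (Fin n) 𝕜 E) {s : Finset (Fin n)}
    {v : E} (hv : v ∈ Submodule.span 𝕜 (b '' (s : Set (Fin n)))) {i : Fin n} (hi : i ∉ s) :
    inner 𝕜 (b i) v = 0 := by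
  induction hv using Submodule.span_induction with
  | mem x hx =>
    obtain ⟨j, hj, rfl⟩ := hx
    rw [OrthonormalBasis.inner_eq_ite, if_neg]
    rintro rfl
    exact hi hj
  | zero => simp
  | add x y _ _ hx hy => rw [inner_add_right, hx, hy, add_zero]
  | smul a x _ hx => rw [inner_smul_right, hx, mul_zero]

theorem diagOp_le_of_mem_span_Ici (b : OrthonormalBasis (Fin n) 𝕜 E) {f : Fin n → ℝ}
    (hf : Antitone f) {i : Fin n} {v : E}
    (hv : v ∈ Submodule.span 𝕜 (b '' (Finset.Ici i : Set (Fin n)))) :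
    RCLike.re (inner 𝕜 (diagOp b f v) v) ≤ f i * ‖v‖ ^ 2 := by
  rw [re_inner_diagOp, ← b.sum_sq_norm_inner_right, Finset.mul_sum]
  refine Finset.sum_le_sum fun j _ => ?_
  by_cases hj : j ∈ Finset.Ici i
  · exact mul_le_mul_of_nonneg_right (hf (Finset.mem_Ici.1 hj)) (sq_nonneg _)
  · simp [inner_eq_zero_of_mem_span_image b hv hj]

theorem le_diagOp_of_mem_span_Iic (b : OrthonormalBasis (Fin n) 𝕜 E) {f : Fin n → ℝ}
    (hf : Antitone f) {i : Fin n} {v : E}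
    (hv : v ∈ Submodule.span 𝕜 (b '' (Finset.Iic i : Set (Fin n)))) :
    f i * ‖v‖ ^ 2 ≤ RCLike.re (inner 𝕜 (diagOp b f v) v) := by
  rw [re_inner_diagOp, ← b.sum_sq_norm_inner_right, Finset.mul_sum]
  refine Finset.sum_le_sum fun j _ => ?_
  by_cases hj : j ∈ Finset.Iic i
  · exact mul_le_mul_of_nonneg_right (hf (Finset.mem_Iic.1 hj)) (sq_nonneg _)
  · simp [inner_eq_zero_of_mem_span_image b hv hj]

variable [FiniteDimensional 𝕜 E]

theorem eq_diagOp_eigenvectorBasis {T : E →ₗ[𝕜] E} (hT : T.IsSymmetric) (hn : finrank 𝕜 E = n) :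
    T = diagOp (hT.eigenvectorBasis hn) (hT.eigenvalues hn) := by
  refine (hT.eigenvectorBasis hn).toBasis.ext fun i => ?_
  simp

/-- The min–max half of the Courant–Fischer principle, in an orthonormal eigenbasis: a subspace of
dimension `i + 1` meets the span of the `b j` with `j ≥ i`. -/
theorem le_of_form_le_diagOp (b : OrthonormalBasis (Fin n) 𝕜 E) {f : Fin n → ℝ} (hf : Antitone f)
    {c : ℝ} {i : Fin n} {V : Submodule 𝕜 E} (hV : i.val + 1 ≤ finrank 𝕜 V)
    (h : ∀ v ∈ V, c * ‖v‖ ^ 2 ≤ RCLike.re (inner 𝕜 (diagOp b f v) v)) : c ≤ f i := by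
  set W := Submodule.span 𝕜 (b '' (Finset.Ici i : Set (Fin n)))
  have hW : finrank 𝕜 W = n - i := by rw [finrank_span_image, Fin.card_Ici]
  have hE : finrank 𝕜 E = n := by simpa using finrank_eq_card_basis b.toBasis
  have hne : V ⊓ W ≠ ⊥ := by
    intro h0
    have h1 := Submodule.finrank_sup_add_finrank_inf_eq V W
    have h2 := Submodule.finrank_le (V ⊔ W)
    rw [h0, finrank_bot] at h1
    have := i.is_lt
    omega
  obtain ⟨v, hv, hv0⟩ := Submodule.exists_mem_ne_zero_of_ne_bot hne
  have hpos : 0 < ‖v‖ ^ 2 := by positivity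
  exact le_of_mul_le_mul_right ((h v hv.1).trans (diagOp_le_of_mem_span_Ici b hf hv.2)) hpos

/-- The max–min half of the Courant–Fischer principle. -/
theorem le_eigenvalues_of_le_form {T : E →ₗ[𝕜] E} (hT : T.IsSymmetric) (hn : finrank 𝕜 E = n)
    {c : ℝ} {i : Fin n} {V : Submodule 𝕜 E} (hV : i.val + 1 ≤ finrank 𝕜 V)
    (h : ∀ v ∈ V, c * ‖v‖ ^ 2 ≤ RCLike.re (inner 𝕜 (T v) v)) : c ≤ hT.eigenvalues hn i := by
  refine le_of_form_le_diagOp (hT.eigenvectorBasis hn) (hT.eigenvalues_antitone hn) hV ?_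
  rwa [← eq_diagOp_eigenvectorBasis]

theorem const_le_form_of_le_eigenvalues {T : E →ₗ[𝕜] E} (hT : T.IsSymmetric)
    (hn : finrank 𝕜 E = n) {c : ℝ} (h : ∀ i, c ≤ hT.eigenvalues hn i) (v : E) :
    c * ‖v‖ ^ 2 ≤ RCLike.re (inner 𝕜 (T v) v) := by
  have := const_le_diagOp (hT.eigenvectorBasis hn) h v
  rwa [← eq_diagOp_eigenvectorBasis] at this

/-- The span of the first `i + 1` eigenvectors. -/
def topEigenspan {T : E →ₗ[𝕜] E} (hT : T.IsSymmetric) (hn : finrank 𝕜 E = n) (i : Fin n) :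
    Submodule 𝕜 E :=
  Submodule.span 𝕜 (hT.eigenvectorBasis hn '' (Finset.Iic i : Set (Fin n)))

theorem finrank_topEigenspan {T : E →ₗ[𝕜] E} (hT : T.IsSymmetric) (hn : finrank 𝕜 E = n)
    (i : Fin n) : finrank 𝕜 (topEigenspan hT hn i) = i.val + 1 := by
  rw [topEigenspan, finrank_span_image, Fin.card_Iic]

theorem le_form_of_mem_topEigenspan {T : E →ₗ[𝕜] E} (hT : T.IsSymmetric) (hn : finrank 𝕜 E = n)
    {i : Fin n} {v : E} (hv : v ∈ topEigenspan hT hn i) :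
    hT.eigenvalues hn i * ‖v‖ ^ 2 ≤ RCLike.re (inner 𝕜 (T v) v) := by
  have := le_diagOp_of_mem_span_Iic (hT.eigenvectorBasis hn) (hT.eigenvalues_antitone hn) hv
  rwa [← eq_diagOp_eigenvectorBasis] at this

/-- On the span of the first `i + 1` eigenvectors, `T² ≥ λᵢ T` if `λᵢ ≥ 0`. -/
theorem mul_form_le_norm_sq_of_mem_topEigenspan {T : E →ₗ[𝕜] E} (hT : T.IsSymmetric)
    (hn : finrank 𝕜 E = n) {i : Fin n} (hi : 0 ≤ hT.eigenvalues hn i) {v : E}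
    (hv : v ∈ topEigenspan hT hn i) :
    hT.eigenvalues hn i * RCLike.re (inner 𝕜 (T v) v) ≤ ‖T v‖ ^ 2 := by
  set b := hT.eigenvectorBasis hn
  set f := hT.eigenvalues hn
  have hTd : T = diagOp b f := eq_diagOp_eigenvectorBasis hT hn
  have hform : RCLike.re (inner 𝕜 (T v) v) = ∑ j, f j * ‖inner 𝕜 (b j) v‖ ^ 2 := by
    rw [hTd, re_inner_diagOp]
  rw [hform, ← b.sum_sq_norm_inner_right, Finset.mul_sum]
  refine Finset.sum_le_sum fun j _ => ?_
  have hj : inner 𝕜 (b j) (T v) = (f j : 𝕜) * inner 𝕜 (b j) v := by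
    rw [hTd, inner_basis_diagOp]
  rw [hj, norm_mul, RCLike.norm_ofReal, mul_pow, sq_abs, ← mul_assoc]
  by_cases hm : j ∈ Finset.Iic i
  · have : f i ≤ f j := hT.eigenvalues_antitone hn (Finset.mem_Iic.1 hm)
    exact mul_le_mul_of_nonneg_right (by nlinarith) (sq_nonneg _)
  · simp [inner_eq_zero_of_mem_span_image b hv hm]

theorem eigenvalues_mono {S T : E →ₗ[𝕜] E} (hS : S.IsSymmetric) (hT : T.IsSymmetric)
    (hn : finrank 𝕜 E = n)
    (h : ∀ v, RCLike.re (inner 𝕜 (S v) v) ≤ RCLike.re (inner 𝕜 (T v) v)) (i : Fin n) :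
    hS.eigenvalues hn i ≤ hT.eigenvalues hn i :=
  le_eigenvalues_of_le_form hT hn (finrank_topEigenspan hS hn i).ge fun v hv =>
    (le_form_of_mem_topEigenspan hS hn hv).trans (h v)

theorem eigenvalues_le_of_le_diagOp {T : E →ₗ[𝕜] E} (hT : T.IsSymmetric)
    (hn : finrank 𝕜 E = n) (b : OrthonormalBasis (Fin n) 𝕜 E) {f : Fin n → ℝ} (hf : Antitone f)
    (h : ∀ v, RCLike.re (inner 𝕜 (T v) v) ≤ RCLike.re (inner 𝕜 (diagOp b f v) v)) (i : Fin n) :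
    hT.eigenvalues hn i ≤ f i :=
  le_of_form_le_diagOp b hf (finrank_topEigenspan hT hn i).ge fun v hv =>
    (le_form_of_mem_topEigenspan hT hn hv).trans (h v)

end Operators

/-! ### Lidskii-type bounds for a product of positive operators -/

section Sandwich

variable {𝕜 E : Type*} [RCLike 𝕜] [NormedAddCommGroup E] [InnerProductSpace 𝕜 E] {n : ℕ}

/-- The operator `D^{1/2} G D^{1/2}`, where `D = diagOp b d` and `G = diagOp u g`. -/
def sandwich (b u : OrthonormalBasis (Fin n) 𝕜 E) (d g : Fin n → ℝ) : E →ₗ[𝕜] E :=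
  diagOp b (fun i => √(d i)) ∘ₗ diagOp u g ∘ₗ diagOp b fun i => √(d i)

theorem sandwich_isSymmetric (b u : OrthonormalBasis (Fin n) 𝕜 E) (d g : Fin n → ℝ) :
    (sandwich b u d g).IsSymmetric := by
  intro x y
  simp only [sandwich, LinearMap.comp_apply]
  rw [diagOp_isSymmetric b, diagOp_isSymmetric u, diagOp_isSymmetric b]

theorem inner_sandwich (b u : OrthonormalBasis (Fin n) 𝕜 E) (d g : Fin n → ℝ) (v : E) :
    inner 𝕜 (sandwich b u d g v) v =
      inner 𝕜 (diagOp u g (diagOp b (fun i => √(d i)) v)) (diagOp b (fun i => √(d i)) v) := by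
  simp only [sandwich, LinearMap.comp_apply]
  rw [diagOp_isSymmetric b]

theorem norm_sq_diagOp_sqrt (b : OrthonormalBasis (Fin n) 𝕜 E) {d : Fin n → ℝ}
    (hd0 : ∀ i, 0 ≤ d i) (v : E) :
    ‖diagOp b (fun i => √(d i)) v‖ ^ 2 = RCLike.re (inner 𝕜 (diagOp b d v) v) := by
  rw [re_inner_diagOp, ← b.sum_sq_norm_inner_right]
  refine Finset.sum_congr rfl fun i _ => ?_
  rw [inner_basis_diagOp, norm_mul, RCLike.norm_ofReal, mul_pow, sq_abs, Real.sq_sqrt (hd0 i)]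

variable [FiniteDimensional 𝕜 E]

/-- The eigenvalues of `D^{1/2} G D^{1/2}` in decreasing order. -/
def sandwichEigenvalues (b u : OrthonormalBasis (Fin n) 𝕜 E) (d g : Fin n → ℝ)
    (hn : finrank 𝕜 E = n) : Fin n → ℝ :=
  (sandwich_isSymmetric b u d g).eigenvalues hn

theorem sandwichEigenvalues_mono (b u : OrthonormalBasis (Fin n) 𝕜 E) (d : Fin n → ℝ)
    {g g' : Fin n → ℝ} (hn : finrank 𝕜 E = n) (h : ∀ i, g i ≤ g' i) (i : Fin n) :
    sandwichEigenvalues b u d g hn i ≤ sandwichEigenvalues b u d g' hn i :=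
  eigenvalues_mono _ _ hn (fun v => by
    rw [inner_sandwich, inner_sandwich]
    exact diagOp_le_diagOp u h _) i

theorem sandwichEigenvalues_nonneg (b u : OrthonormalBasis (Fin n) 𝕜 E) (d : Fin n → ℝ)
    {g : Fin n → ℝ} (hn : finrank 𝕜 E = n) (h : ∀ i, 0 ≤ g i) (i : Fin n) :
    0 ≤ sandwichEigenvalues b u d g hn i :=
  le_eigenvalues_of_le_form (V := ⊤) _ hn (by rw [finrank_top, hn]; exact i.is_lt) fun v _ => by
    rw [inner_sandwich, zero_mul]
    exact (const_le_diagOp u h _).trans' (by simp)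

theorem sandwichEigenvalues_le_mul (b u : OrthonormalBasis (Fin n) 𝕜 E) {d g : Fin n → ℝ}
    (hn : finrank 𝕜 E = n) (hd : Antitone d) (hd0 : ∀ i, 0 ≤ d i) {c : ℝ} (hc : 0 ≤ c)
    (h : ∀ i, g i ≤ c) (i : Fin n) :
    sandwichEigenvalues b u d g hn i ≤ c * d i := by
  refine eigenvalues_le_of_le_diagOp (f := fun i => c * d i) _ hn b
    (fun i j hij => mul_le_mul_of_nonneg_left (hd hij) hc) (fun v => ?_) i
  rw [inner_sandwich]
  refine (diagOp_le_const u h _).trans (le_of_eq ?_)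
  rw [norm_sq_diagOp_sqrt b hd0, re_inner_diagOp, re_inner_diagOp, Finset.mul_sum]
  exact Finset.sum_congr rfl fun i _ => (mul_assoc _ _ _).symm

theorem sum_sandwichEigenvalues (b u : OrthonormalBasis (Fin n) 𝕜 E) {d : Fin n → ℝ}
    (g : Fin n → ℝ) (hn : finrank 𝕜 E = n) (hd0 : ∀ i, 0 ≤ d i) :
    ∑ i, sandwichEigenvalues b u d g hn i
      = ∑ i, ∑ j, d i * g j * ‖inner 𝕜 (u j) (b i)‖ ^ 2 := by
  subst hn
  rw [sandwichEigenvalues, ← LinearMap.IsSymmetric.re_trace_eq_sum_eigenvalues rfl,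
    LinearMap.trace_eq_sum_inner _ b, map_sum]
  refine Finset.sum_congr rfl fun i _ => ?_
  rw [← sandwich_isSymmetric, inner_sandwich, diagOp_basis, map_smul, inner_smul_left,
    inner_smul_right, RCLike.conj_ofReal, ← mul_assoc, ← RCLike.ofReal_mul,
    Real.mul_self_sqrt (hd0 i), RCLike.re_ofReal_mul, re_inner_diagOp, Finset.mul_sum]
  exact Finset.sum_congr rfl fun j _ => (mul_assoc _ _ _).symm

theorem prod_sandwichEigenvalues (b u : OrthonormalBasis (Fin n) 𝕜 E) {d : Fin n → ℝ}
    (g : Fin n → ℝ) (hn : finrank 𝕜 E = n) (hd0 : ∀ i, 0 ≤ d i) :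
    ∏ i, sandwichEigenvalues b u d g hn i = ∏ i, d i * g i := by
  have h := (sandwich_isSymmetric b u d g).det_eq_prod_eigenvalues hn
  have hdet : LinearMap.det (sandwich b u d g)
      = (((∏ i, √(d i)) * ((∏ i, g i) * ∏ i, √(d i)) : ℝ) : 𝕜) := by
    rw [sandwich, LinearMap.det_comp, LinearMap.det_comp, det_diagOp, det_diagOp,
      ← RCLike.ofReal_mul, ← RCLike.ofReal_mul]
  rw [hdet, ← RCLike.ofReal_prod, RCLike.ofReal_inj] at h
  rw [sandwichEigenvalues, ← h, ← Finset.prod_mul_distrib, ← Finset.prod_mul_distrib]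
  refine Finset.prod_congr rfl fun i _ => ?_
  linear_combination g i * Real.mul_self_sqrt (hd0 i)

/-- Additive bound: sums of entries of `λ(D) - λ(D^{1/2} G D^{1/2})` are bounded by partial sums
of `d (1 - g)`. Truncating `G` at its `k`-th smallest eigenvalue `c` lowers the eigenvalues and
puts them below `c d`; the sum of the `k` gaps to `c d` is then at most the sum of all of them,
which is a trace. -/
theorem sum_sub_sandwichEigenvalues_le (b u : OrthonormalBasis (Fin n) 𝕜 E) {d g : Fin n → ℝ}
    (hn : finrank 𝕜 E = n) (hd : Antitone d) (hd0 : ∀ i, 0 ≤ d i) (hg : Monotone g)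
    (hg0 : ∀ i, 0 ≤ g i) (hg1 : ∀ i, g i ≤ 1) {I : Finset (Fin n)} (hI : I.Nonempty) :
    ∑ i ∈ I, (d i - sandwichEigenvalues b u d g hn i)
      ≤ ∑ i : Fin n with i.val < I.card, d i * (1 - g i) := by
  have hk : I.card ≤ n := by simpa using I.card_le_univ
  have hk1 : 0 < I.card := hI.card_pos
  set k := I.card with hkdef
  set c := g ⟨k - 1, by omega⟩ with hc
  -- The eigenvalues of the truncated product `D^{1/2} min(G, c) D^{1/2}`.
  set z := sandwichEigenvalues b u d (fun i => min (g i) c) hn with hz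
  have hzγ : ∀ i, z i ≤ sandwichEigenvalues b u d g hn i :=
    sandwichEigenvalues_mono b u d hn fun i => min_le_left _ _
  have hzc : ∀ i, z i ≤ c * d i :=
    sandwichEigenvalues_le_mul b u hn hd hd0 (hg0 _) fun i => min_le_right _ _
  have hrow : ∀ i, ∑ j, ‖inner 𝕜 (u j) (b i)‖ ^ 2 = 1 := fun i => by
    rw [u.sum_sq_norm_inner_right, b.norm_eq_one, one_pow]
  have hcol : ∀ j, ∑ i, ‖inner 𝕜 (u j) (b i)‖ ^ 2 = 1 := fun j => by
    rw [b.sum_sq_norm_inner_left, u.norm_eq_one, one_pow]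
  have h1 : ∑ i ∈ I, (c * d i - z i) ≤ ∑ i, (c * d i - z i) :=
    Finset.sum_le_sum_of_subset_of_nonneg (Finset.subset_univ I)
      fun i _ _ => sub_nonneg.2 (hzc i)
  have h2 : ∑ i, (c * d i - z i)
      = ∑ i, ∑ j, d i * (c - min (g j) c) * ‖inner 𝕜 (u j) (b i)‖ ^ 2 := by
    rw [Finset.sum_sub_distrib, hz, sum_sandwichEigenvalues b u _ hn hd0,
      ← Finset.sum_sub_distrib]
    refine Finset.sum_congr rfl fun i _ => ?_
    calc c * d i - ∑ j, d i * min (g j) c * ‖inner 𝕜 (u j) (b i)‖ ^ 2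
        = ∑ j, c * d i * ‖inner 𝕜 (u j) (b i)‖ ^ 2
          - ∑ j, d i * min (g j) c * ‖inner 𝕜 (u j) (b i)‖ ^ 2 := by
          rw [← Finset.mul_sum, hrow, mul_one]
      _ = _ := by
          rw [← Finset.sum_sub_distrib]
          exact Finset.sum_congr rfl fun j _ => by ring
  have h3 : ∑ i, ∑ j, d i * (c - min (g j) c) * ‖inner 𝕜 (u j) (b i)‖ ^ 2
      ≤ ∑ j, d j * (c - min (g j) c) :=
    sum_sum_mul_mul_le_of_doublyStochastic hd
      (fun i j hij => sub_le_sub_left (min_le_min_right c (hg hij)) c)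
      (fun i => sub_nonneg.2 (min_le_right _ _)) (fun i j => sq_nonneg _) hrow hcol
  have h4 : ∑ j, d j * (c - min (g j) c) = ∑ j : Fin n with j.val < k, d j * (c - g j) := by
    rw [Finset.sum_filter]
    refine Finset.sum_congr rfl fun j _ => ?_
    split_ifs with hj
    · rw [min_eq_left (hg (by rw [Fin.le_def]; simp; omega))]
    · rw [min_eq_right (hg (by rw [Fin.le_def]; simp; omega)), sub_self, mul_zero]
  have h5 : (1 - c) * ∑ i ∈ I, d i ≤ (1 - c) * ∑ i : Fin n with i.val < k, d i :=
    mul_le_mul_of_nonneg_left (sum_le_sum_filter_of_antitone hd I) (sub_nonneg.2 (hg1 _))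
  calc ∑ i ∈ I, (d i - sandwichEigenvalues b u d g hn i)
      ≤ ∑ i ∈ I, ((1 - c) * d i + (c * d i - z i)) :=
        Finset.sum_le_sum fun i _ => by linarith [hzγ i]
    _ = (1 - c) * ∑ i ∈ I, d i + ∑ i ∈ I, (c * d i - z i) := by
        rw [Finset.sum_add_distrib, Finset.mul_sum]
    _ ≤ (1 - c) * ∑ i : Fin n with i.val < k, d i
          + ∑ j : Fin n with j.val < k, d j * (c - g j) := by linarith
    _ = _ := by
        rw [Finset.mul_sum, ← Finset.sum_add_distrib]
        exact Finset.sum_congr rfl fun i _ => by ring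

theorem sandwichEigenvalues_pos (b u : OrthonormalBasis (Fin n) 𝕜 E) {d g : Fin n → ℝ}
    (hn : finrank 𝕜 E = n) (hd0 : ∀ i, 0 < d i) (hg0 : ∀ i, 0 < g i) (i : Fin n) :
    0 < sandwichEigenvalues b u d g hn i := by
  have hprod := prod_sandwichEigenvalues b u g hn fun i => (hd0 i).le
  have hne : ∏ i, sandwichEigenvalues b u d g hn i ≠ 0 := by
    rw [hprod]
    exact (Finset.prod_pos fun i _ => mul_pos (hd0 i) (hg0 i)).ne'
  exact lt_of_le_of_ne (sandwichEigenvalues_nonneg b u d hn (fun i => (hg0 i).le) i)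
    (Finset.prod_ne_zero_iff.1 hne i (Finset.mem_univ i)).symm

/-- Multiplicative bound: the analogue of `sum_sub_sandwichEigenvalues_le` for the ratios
`λ(D) / λ(D^{1/2} G D^{1/2})`, with the determinant in place of the trace. -/
theorem sum_log_div_sandwichEigenvalues_le (b u : OrthonormalBasis (Fin n) 𝕜 E) {d g : Fin n → ℝ}
    (hn : finrank 𝕜 E = n) (hd : Antitone d) (hd0 : ∀ i, 0 < d i) (hg : Monotone g)
    (hg0 : ∀ i, 0 < g i) {I : Finset (Fin n)} (hI : I.Nonempty) :
    ∑ i ∈ I, (Real.log (d i) - Real.log (sandwichEigenvalues b u d g hn i))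
      ≤ ∑ i : Fin n with i.val < I.card, - Real.log (g i) := by
  have hk : I.card ≤ n := by simpa using I.card_le_univ
  have hk1 : 0 < I.card := hI.card_pos
  set k := I.card with hkdef
  set c := g ⟨k - 1, by omega⟩ with hc
  have hc0 : 0 < c := hg0 _
  have hm0 : ∀ i, 0 < min (g i) c := fun i => lt_min (hg0 i) hc0
  -- The eigenvalues of the truncated product `D^{1/2} min(G, c) D^{1/2}`.
  set z := sandwichEigenvalues b u d (fun i => min (g i) c) hn with hz
  have hz0 : ∀ i, 0 < z i := sandwichEigenvalues_pos b u hn hd0 hm0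
  have hzγ : ∀ i, Real.log (z i) ≤ Real.log (sandwichEigenvalues b u d g hn i) := fun i =>
    Real.log_le_log (hz0 i) (sandwichEigenvalues_mono b u d hn (fun i => min_le_left _ _) i)
  have hzc : ∀ i, Real.log (z i) ≤ Real.log c + Real.log (d i) := fun i => by
    rw [← Real.log_mul hc0.ne' (hd0 i).ne']
    exact Real.log_le_log (hz0 i) (sandwichEigenvalues_le_mul b u hn hd (fun i => (hd0 i).le)
      hc0.le (fun i => min_le_right _ _) i)
  have h1 : ∑ i ∈ I, (Real.log c + Real.log (d i) - Real.log (z i))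
      ≤ ∑ i, (Real.log c + Real.log (d i) - Real.log (z i)) :=
    Finset.sum_le_sum_of_subset_of_nonneg (Finset.subset_univ I)
      fun i _ _ => sub_nonneg.2 (hzc i)
  have h2 : ∑ i, Real.log (z i) = ∑ i, (Real.log (d i) + Real.log (min (g i) c)) := by
    rw [← Real.log_prod fun i _ => (hz0 i).ne', hz,
      prod_sandwichEigenvalues b u _ hn fun i => (hd0 i).le,
      Real.log_prod fun i _ => (mul_pos (hd0 i) (hm0 i)).ne']
    exact Finset.sum_congr rfl fun i _ => Real.log_mul (hd0 i).ne' (hm0 i).ne'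
  have h3 : ∑ i, (Real.log c + Real.log (d i) - Real.log (z i))
      = ∑ i : Fin n with i.val < k, (Real.log c - Real.log (g i)) := by
    rw [Finset.sum_sub_distrib, h2, ← Finset.sum_sub_distrib, Finset.sum_filter]
    refine Finset.sum_congr rfl fun j _ => ?_
    split_ifs with hj
    · rw [min_eq_left (hg (by rw [Fin.le_def]; simp; omega))]
      ring
    · rw [min_eq_right (hg (by rw [Fin.le_def]; simp; omega))]
      ring
  calc ∑ i ∈ I, (Real.log (d i) - Real.log (sandwichEigenvalues b u d g hn i))
      ≤ ∑ i ∈ I, (Real.log c + Real.log (d i) - Real.log (z i) - Real.log c) :=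
        Finset.sum_le_sum fun i _ => by linarith [hzγ i]
    _ = ∑ i ∈ I, (Real.log c + Real.log (d i) - Real.log (z i)) - k * Real.log c := by
        rw [Finset.sum_sub_distrib, Finset.sum_const, nsmul_eq_mul]
    _ ≤ ∑ i : Fin n with i.val < k, (Real.log c - Real.log (g i)) - k * Real.log c := by linarith
    _ = _ := by
        rw [Finset.sum_sub_distrib, Finset.sum_const, card_filter_val_lt hk, nsmul_eq_mul,
          Finset.sum_neg_distrib]
        ring

end Sandwich

/-! ### Rayleigh–Ritz operators -/

section Ritz

variable {𝕜 H : Type*} [RCLike 𝕜] [NormedAddCommGroup H] [InnerProductSpace 𝕜 H]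
  [FiniteDimensional 𝕜 H]

theorem inner_ritzOperator (A : H →ₗ[𝕜] H) (W : Submodule 𝕜 H) (w : W) :
    inner 𝕜 (ritzOperator A W w) w = inner 𝕜 (A w) (w : H) := by
  simp only [ritzOperator, LinearMap.comp_apply, Submodule.subtype_apply,
    ContinuousLinearMap.coe_coe, Submodule.inner_orthogonalProjectionOnto_eq_of_mem_right]

theorem minRitzValue_mul_norm_sq_le {A : H →ₗ[𝕜] H} (hA : A.IsSymmetric) {W : Submodule 𝕜 H}
    {w : H} (hw : w ∈ W) :
    minRitzValue hA W * ‖w‖ ^ 2 ≤ RCLike.re (inner 𝕜 (A w) w) := by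
  have h := const_le_form_of_le_eigenvalues (ritzOperator_isSymmetric hA W) rfl
    (c := minRitzValue hA W) (fun i => ciInf_le (Set.finite_range _).bddBelow i) ⟨w, hw⟩
  rwa [inner_ritzOperator] at h

theorem le_ritzValues_of_le_form {A : H →ₗ[𝕜] H} (hA : A.IsSymmetric) {W : Submodule 𝕜 H} {c : ℝ}
    (h : ∀ w ∈ W, c * ‖w‖ ^ 2 ≤ RCLike.re (inner 𝕜 (A w) w)) (i : Fin (finrank 𝕜 W)) :
    c ≤ ritzValues hA W i :=
  le_eigenvalues_of_le_form (V := ⊤) _ rfl (by rw [finrank_top]; exact i.is_lt) fun w _ => by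
    rw [inner_ritzOperator]
    exact h w w.2

/-- Cauchy interlacing: Ritz values are at most the corresponding eigenvalues. -/
theorem ritzValues_le_eigenvalues {A : H →ₗ[𝕜] H} (hA : A.IsSymmetric) (W : Submodule 𝕜 H)
    (i : Fin (finrank 𝕜 W)) :
    ritzValues hA W i ≤ hA.eigenvalues rfl (Fin.castLE (Submodule.finrank_le W) i) := by
  have hsymm := ritzOperator_isSymmetric hA W
  refine le_eigenvalues_of_le_form hA rfl (V := (topEigenspan hsymm rfl i).map W.subtype) ?_ ?_
  · rw [Submodule.finrank_map_subtype_eq, finrank_topEigenspan]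
    rfl
  · rintro _ ⟨v, hv, rfl⟩
    have := le_form_of_mem_topEigenspan hsymm rfl hv
    rwa [inner_ritzOperator] at this

/-- If `A - c` is positive on `S ⊇ X`, then replacing `w ∈ S` by its projection to the invariant
subspace `X` does not increase the form of `A - c`: the form splits along `X` and `Xᗮ`, and the
part on `Xᗮ ∩ S` is nonnegative. -/
theorem form_orthogonalProjection_le {A : H →ₗ[𝕜] H} (hA : A.IsSymmetric) {X S : Submodule 𝕜 H}
    (hinv : ∀ x ∈ X, A x ∈ X) (hXS : X ≤ S) {c : ℝ}
    (hc : ∀ w ∈ S, c * ‖w‖ ^ 2 ≤ RCLike.re (inner 𝕜 (A w) w)) {w : H} (hw : w ∈ S) :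
    RCLike.re (inner 𝕜 (A (X.starProjection w)) (X.starProjection w))
        - c * ‖X.starProjection w‖ ^ 2
      ≤ RCLike.re (inner 𝕜 (A w) w) - c * ‖w‖ ^ 2 := by
  set p := X.starProjection w with hp
  have hpX : p ∈ X := X.starProjection_apply_mem w
  set q := w - p with hq
  have hqX : q ∈ Xᗮ := X.sub_starProjection_mem_orthogonal w
  have hw' : w = p + q := by rw [hq]; abel
  have hqS : q ∈ S := S.sub_mem hw (hXS hpX)
  have h1 : inner 𝕜 (A p) q = 0 := Submodule.inner_right_of_mem_orthogonal (hinv p hpX) hqX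
  have h2 : inner 𝕜 (A q) p = 0 := by
    rw [hA]; exact Submodule.inner_left_of_mem_orthogonal (hinv p hpX) hqX
  have h3 : ‖w‖ ^ 2 = ‖p‖ ^ 2 + ‖q‖ ^ 2 := by
    have := norm_add_sq_eq_norm_sq_add_norm_sq_of_inner_eq_zero p q
      (Submodule.inner_right_of_mem_orthogonal hpX hqX)
    rw [hw', sq, sq, sq, this]
  have h4 : RCLike.re (inner 𝕜 (A w) w)
      = RCLike.re (inner 𝕜 (A p) p) + RCLike.re (inner 𝕜 (A q) q) := by
    conv_lhs => rw [hw']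
    simp only [map_add, inner_add_left, inner_add_right, h1, h2, add_zero, zero_add]
  have := hc q hqS
  rw [h3, h4]
  linarith

/-! ### Principal angles -/

/-- An orthonormal basis of `X` of eigenvectors of `(P_X P_Y)|_X`, ordered as `cosSqAngles`. -/
def cosSqBasis (X Y : Submodule 𝕜 H) : OrthonormalBasis (Fin (finrank 𝕜 X)) 𝕜 X :=
  ((ritzOperator_isSymmetric Y.starProjection_isSymmetric X).eigenvectorBasis rfl).reindex
    Fin.revPerm

theorem diagOp_cosSqBasis (X Y : Submodule 𝕜 H) :
    diagOp (cosSqBasis X Y) (cosSqAngles X Y) = ritzOperator Y.starProjection X := by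
  refine (cosSqBasis X Y).toBasis.ext fun i => ?_
  rw [OrthonormalBasis.coe_toBasis, diagOp_basis, cosSqBasis, OrthonormalBasis.reindex_apply,
    LinearMap.IsSymmetric.apply_eigenvectorBasis]
  rfl

theorem cosSqAngles_monotone (X Y : Submodule 𝕜 H) : Monotone (cosSqAngles X Y) := fun _ _ h =>
  LinearMap.IsSymmetric.eigenvalues_antitone _ rfl (Fin.rev_le_rev.2 h)

theorem re_inner_diagOp_cosSq (X Y : Submodule 𝕜 H) (x : X) :
    RCLike.re (inner 𝕜 (diagOp (cosSqBasis X Y) (cosSqAngles X Y) x) x)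
      = ‖Y.starProjection (x : H)‖ ^ 2 := by
  rw [diagOp_cosSqBasis, inner_ritzOperator]
  exact Y.re_inner_starProjection_eq_normSq (x : H)

theorem cosSqAngles_eq_norm_sq (X Y : Submodule 𝕜 H) (i : Fin (finrank 𝕜 X)) :
    cosSqAngles X Y i = ‖Y.starProjection (cosSqBasis X Y i : H)‖ ^ 2 := by
  rw [← re_inner_diagOp_cosSq, diagOp_basis, inner_smul_left, OrthonormalBasis.inner_eq_one]
  simp

theorem cosSqAngles_nonneg (X Y : Submodule 𝕜 H) (i : Fin (finrank 𝕜 X)) :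
    0 ≤ cosSqAngles X Y i := by
  rw [cosSqAngles_eq_norm_sq]
  positivity

theorem cosSqAngles_le_one (X Y : Submodule 𝕜 H) (i : Fin (finrank 𝕜 X)) :
    cosSqAngles X Y i ≤ 1 := by
  rw [cosSqAngles_eq_norm_sq]
  refine pow_le_one₀ (norm_nonneg _) ((Y.norm_starProjection_apply_le _).trans ?_)
  exact ((cosSqBasis X Y).norm_eq_one i).le

theorem cos_angles (X Y : Submodule 𝕜 H) (i : Fin (finrank 𝕜 X)) :
    Real.cos (angles X Y i) = √(cosSqAngles X Y i) :=
  Real.cos_arccos (by linarith [Real.sqrt_nonneg (cosSqAngles X Y i)])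
    (Real.sqrt_le_one.2 (cosSqAngles_le_one X Y i))

theorem sin_angles_sq (X Y : Submodule 𝕜 H) (i : Fin (finrank 𝕜 X)) :
    Real.sin (angles X Y i) ^ 2 = 1 - cosSqAngles X Y i := by
  rw [Real.sin_sq, cos_angles, Real.sq_sqrt (cosSqAngles_nonneg X Y i)]

theorem cosSqAngles_pos {X Y : Submodule 𝕜 H} {i : Fin (finrank 𝕜 X)}
    (h : angles X Y i < Real.pi / 2) : 0 < cosSqAngles X Y i :=
  Real.sqrt_pos.1 (Real.arccos_lt_pi_div_two.1 h)

theorem one_add_tan_angles_sq {X Y : Submodule 𝕜 H} {i : Fin (finrank 𝕜 X)}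
    (h : angles X Y i < Real.pi / 2) :
    1 + Real.tan (angles X Y i) ^ 2 = (cosSqAngles X Y i)⁻¹ := by
  have hpos := cosSqAngles_pos h
  have hc : Real.cos (angles X Y i) ≠ 0 := by
    rw [cos_angles]
    exact (Real.sqrt_pos.2 hpos).ne'
  rw [← inv_inv (1 + _), Real.inv_one_add_tan_sq hc, cos_angles, Real.sq_sqrt hpos.le]

/-! ### Ritz values on `Y` in terms of an invariant subspace `X` -/

/-- With `R` the square root of `(A - c)|_X`, the Ritz values on `Y`, shifted by `c`, dominate the
eigenvalues of `R P_X P_Y R`: for an eigenspan `V ⊆ X` of the latter, the form of `A - c` is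
large enough on the trial subspace `P_Y R V`. -/
theorem sandwichEigenvalues_le_ritzValues_sub {A : H →ₗ[𝕜] H} (hA : A.IsSymmetric)
    {X Y : Submodule 𝕜 H} (hdim : finrank 𝕜 X ≤ finrank 𝕜 Y) (hinv : ∀ x ∈ X, A x ∈ X) {c : ℝ}
    (hc : ∀ w ∈ X ⊔ Y, c * ‖w‖ ^ 2 ≤ RCLike.re (inner 𝕜 (A w) w)) (i : Fin (finrank 𝕜 X)) :
    sandwichEigenvalues ((ritzOperator_isSymmetric hA X).eigenvectorBasis rfl) (cosSqBasis X Y)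
        (fun i => ritzValues hA X i - c) (cosSqAngles X Y) rfl i
      ≤ largestRitzValues hA X Y hdim i - c := by
  set b := (ritzOperator_isSymmetric hA X).eigenvectorBasis rfl with hb
  set d : Fin (finrank 𝕜 X) → ℝ := fun i => ritzValues hA X i - c with hd
  have hd0 : ∀ i, 0 ≤ d i := fun i => sub_nonneg.2
    (le_ritzValues_of_le_form hA (fun w hw => hc w (le_sup_left (a := X) hw)) i)
  set R := diagOp b fun i => √(d i) with hR
  set N := sandwich b (cosSqBasis X Y) d (cosSqAngles X Y) with hN
  have hNsymm : N.IsSymmetric := sandwich_isSymmetric b _ d _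
  have hNR : ∀ v, N v = R (ritzOperator Y.starProjection X (R v)) := fun v => by
    rw [← diagOp_cosSqBasis]
    rfl
  set γ := sandwichEigenvalues b (cosSqBasis X Y) d (cosSqAngles X Y) rfl i with hγ
  have hγ0 : 0 ≤ γ := sandwichEigenvalues_nonneg b _ d rfl (cosSqAngles_nonneg X Y) i
  rw [le_sub_iff_add_le]
  -- The form of the shifted operator on `X` is the squared norm of `R`.
  have hRform : ∀ p : X, RCLike.re (inner 𝕜 (A p) (p : H)) - c * ‖(p : H)‖ ^ 2 = ‖R p‖ ^ 2 := by
    intro p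
    have h1 : RCLike.re (inner 𝕜 (A p) (p : H))
        = ∑ j, ritzValues hA X j * ‖inner 𝕜 (b j) p‖ ^ 2 := by
      rw [← inner_ritzOperator,
        eq_diagOp_eigenvectorBasis (ritzOperator_isSymmetric hA X) rfl, re_inner_diagOp]
      rfl
    have h2 : ‖(p : H)‖ ^ 2 = ∑ j, ‖inner 𝕜 (b j) p‖ ^ 2 := (b.sum_sq_norm_inner_right p).symm
    rw [hR, norm_sq_diagOp_sqrt b hd0, re_inner_diagOp, h1, h2, Finset.mul_sum,
      ← Finset.sum_sub_distrib]
    exact Finset.sum_congr rfl fun j _ => (sub_mul _ _ _).symm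
  -- If `γ = 0`, then `P_Y R` need not be injective on the eigenspan, but `Y ≤ X ⊔ Y` suffices.
  rcases hγ0.eq_or_lt with h0 | hpos
  · rw [← h0, zero_add]
    exact le_ritzValues_of_le_form hA (fun w hw => hc w (le_sup_right (a := X) hw)) _
  · let L : X →ₗ[𝕜] Y := (Y.orthogonalProjectionOnto : H →ₗ[𝕜] Y) ∘ₗ X.subtype ∘ₗ R
    have hLcoe : ∀ v, (L v : H) = Y.starProjection (R v : H) := fun v => rfl
    have hLnorm : ∀ v, ‖L v‖ ^ 2 = RCLike.re (inner 𝕜 (N v) v) := fun v => by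
      rw [hN, inner_sandwich, re_inner_diagOp_cosSq]
      rfl
    set V := topEigenspan hNsymm rfl i with hV
    have hform : ∀ v ∈ V, γ * ‖v‖ ^ 2 ≤ ‖L v‖ ^ 2 := fun v hv => by
      rw [hLnorm]
      exact le_form_of_mem_topEigenspan hNsymm rfl hv
    have hrank : finrank 𝕜 (V.map L) = i.val + 1 := by
      rw [← LinearMap.range_domRestrict, LinearMap.finrank_range_of_inj,
        hV, finrank_topEigenspan]
      rw [← LinearMap.ker_eq_bot, LinearMap.ker_eq_bot']
      intro v hv
      have h1 := hform v v.2
      have h2 : L v = 0 := hv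
      rw [h2, norm_zero] at h1
      have h3 : ‖(v : X)‖ ^ 2 ≤ 0 := by
        by_contra hcon
        push Not at hcon
        nlinarith
      have h4 : ‖(v : X)‖ = 0 := by nlinarith [norm_nonneg (v : X)]
      exact Subtype.ext (norm_eq_zero.1 h4)
    refine le_eigenvalues_of_le_form (ritzOperator_isSymmetric hA Y) rfl (V := V.map L)
      (by rw [hrank]; rfl) ?_
    rintro _ ⟨v, hv, rfl⟩
    have h1 := form_orthogonalProjection_le hA hinv le_sup_left hc
      (le_sup_right (a := X) (L v).2)
    have h2 := mul_form_le_norm_sq_of_mem_topEigenspan hNsymm rfl hγ0 hv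
    have h3 : N v = R (X.orthogonalProjectionOnto (L v : H)) := hNR v
    have h4 := hRform (X.orthogonalProjectionOnto (L v : H))
    rw [← h3] at h4
    rw [← hLnorm] at h2
    rw [inner_ritzOperator, add_mul]
    have h5 : ‖(L v : H)‖ = ‖L v‖ := rfl
    have h6 : X.starProjection (L v : H) = (X.orthogonalProjectionOnto (L v : H) : H) := rfl
    rw [h6, h4, h5] at h1
    have h7 : γ * ‖L v‖ ^ 2 ≤ ‖N v‖ ^ 2 := h2
    linarith

end Ritz

end RayleighRitz

end

theorem theorem2p5 {𝕜 H : Type*} [RCLike 𝕜] [NormedAddCommGroup H] [InnerProductSpace 𝕜 H]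
    [FiniteDimensional 𝕜 H] (A : H →ₗ[𝕜] H) (hA : A.IsSymmetric) (X Y : Submodule 𝕜 H)
    (hdim : Module.finrank 𝕜 X ≤ Module.finrank 𝕜 Y)
    (hX : RayleighRitz.IsTopInvariant hA X) :
    ((∀ i, 0 ≤ RayleighRitz.ritzValues hA X i - RayleighRitz.largestRitzValues hA X Y hdim i) ∧
      RayleighRitz.WeaklyMajorizedBy
        (fun i => RayleighRitz.ritzValues hA X i - RayleighRitz.largestRitzValues hA X Y hdim i)
        (fun i => (RayleighRitz.ritzValues hA X i - RayleighRitz.minRitzValue hA (X ⊔ Y)) *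
          Real.sin (RayleighRitz.angles X Y i) ^ 2)) ∧
    ((∀ i, RayleighRitz.angles X Y i < Real.pi / 2) →
      (∀ i, RayleighRitz.minRitzValue hA (X ⊔ Y) < RayleighRitz.ritzValues hA X i) →
      (∀ i, RayleighRitz.minRitzValue hA (X ⊔ Y) <
        RayleighRitz.largestRitzValues hA X Y hdim i) ∧
      ((∀ i, 0 ≤ Real.log
          ((RayleighRitz.ritzValues hA X i - RayleighRitz.minRitzValue hA (X ⊔ Y)) /
            (RayleighRitz.largestRitzValues hA X Y hdim i -
              RayleighRitz.minRitzValue hA (X ⊔ Y)))) ∧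
        RayleighRitz.WeaklyMajorizedBy
          (fun i => Real.log
            ((RayleighRitz.ritzValues hA X i - RayleighRitz.minRitzValue hA (X ⊔ Y)) /
              (RayleighRitz.largestRitzValues hA X Y hdim i -
                RayleighRitz.minRitzValue hA (X ⊔ Y))))
          (fun i => Real.log (1 + Real.tan (RayleighRitz.angles X Y i) ^ 2))) ∧
      ((∀ i, 0 ≤
          (RayleighRitz.ritzValues hA X i - RayleighRitz.largestRitzValues hA X Y hdim i) /
            (RayleighRitz.largestRitzValues hA X Y hdim i -
              RayleighRitz.minRitzValue hA (X ⊔ Y))) ∧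
        RayleighRitz.WeaklyMajorizedBy
          (fun i =>
            (RayleighRitz.ritzValues hA X i - RayleighRitz.largestRitzValues hA X Y hdim i) /
              (RayleighRitz.largestRitzValues hA X Y hdim i -
                RayleighRitz.minRitzValue hA (X ⊔ Y)))
          (fun i => Real.tan (RayleighRitz.angles X Y i) ^ 2))) := by
  have hinv := hX.1
  set c := RayleighRitz.minRitzValue hA (X ⊔ Y) with hcdef
  set α := RayleighRitz.ritzValues hA X with hα
  set β := RayleighRitz.largestRitzValues hA X Y hdim with hβ
  have hc : ∀ w ∈ X ⊔ Y, c * ‖w‖ ^ 2 ≤ RCLike.re (inner 𝕜 (A w) w) := fun w hw =>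
    RayleighRitz.minRitzValue_mul_norm_sq_le hA hw
  have hd : Antitone fun i => α i - c := fun i j hij =>
    sub_le_sub_right (LinearMap.IsSymmetric.eigenvalues_antitone _ rfl hij) c
  have hγβ := RayleighRitz.sandwichEigenvalues_le_ritzValues_sub hA hdim hinv hc
  have hβα : ∀ i, β i ≤ α i := fun i =>
    (RayleighRitz.ritzValues_le_eigenvalues hA Y _).trans (hX.2 i).ge
  have hg := RayleighRitz.cosSqAngles_monotone X Y
  refine ⟨⟨fun i => sub_nonneg.2 (hβα i), ?_⟩, fun hθ hcα => ?_⟩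
  · refine RayleighRitz.WeaklyMajorizedBy.of_forall_finset fun I hI => ?_
    have hd0 : ∀ i, 0 ≤ α i - c := fun i => sub_nonneg.2
      (RayleighRitz.le_ritzValues_of_le_form hA (fun w hw => hc w (le_sup_left (a := X) hw)) i)
    have h := RayleighRitz.sum_sub_sandwichEigenvalues_le
      ((RayleighRitz.ritzOperator_isSymmetric hA X).eigenvectorBasis rfl)
      (RayleighRitz.cosSqBasis X Y) rfl hd hd0 hg (RayleighRitz.cosSqAngles_nonneg X Y)
      (RayleighRitz.cosSqAngles_le_one X Y) hI
    simp only [RayleighRitz.sin_angles_sq]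
    exact (Finset.sum_le_sum fun i _ => by linarith [hγβ i]).trans h
  · have hd0 : ∀ i, 0 < α i - c := fun i => sub_pos.2 (hcα i)
    have hg0 : ∀ i, 0 < RayleighRitz.cosSqAngles X Y i := fun i =>
      RayleighRitz.cosSqAngles_pos (hθ i)
    have hγ0 := RayleighRitz.sandwichEigenvalues_pos
      ((RayleighRitz.ritzOperator_isSymmetric hA X).eigenvectorBasis rfl)
      (RayleighRitz.cosSqBasis X Y) rfl hd0 hg0
    have hβ0 : ∀ i, 0 < β i - c := fun i => (hγ0 i).trans_le (hγβ i)
    have hlog : RayleighRitz.WeaklyMajorizedBy (fun i => Real.log ((α i - c) / (β i - c)))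
        (fun i => Real.log (1 + Real.tan (RayleighRitz.angles X Y i) ^ 2)) := by
      refine RayleighRitz.WeaklyMajorizedBy.of_forall_finset fun I hI => ?_
      have h := RayleighRitz.sum_log_div_sandwichEigenvalues_le
        ((RayleighRitz.ritzOperator_isSymmetric hA X).eigenvectorBasis rfl)
        (RayleighRitz.cosSqBasis X Y) rfl hd hd0 hg hg0 hI
      simp only [RayleighRitz.one_add_tan_angles_sq (hθ _), Real.log_inv]
      refine (Finset.sum_le_sum fun i _ => ?_).trans h
      rw [Real.log_div (hd0 i).ne' (hβ0 i).ne']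
      exact sub_le_sub_left (Real.log_le_log (hγ0 i) (hγβ i)) _
    refine ⟨fun i => sub_pos.1 (hβ0 i), ⟨fun i => Real.log_nonneg ?_, hlog⟩,
      fun i => div_nonneg (sub_nonneg.2 (hβα i)) (hβ0 i).le, ?_⟩
    · rw [one_le_div (hβ0 i)]
      exact sub_le_sub_right (hβα i) c
    · convert hlog.exp_sub_one using 1
      · funext i
        rw [Real.exp_log (div_pos (hd0 i) (hβ0 i)), eq_sub_iff_add_eq,
          div_add_one (hβ0 i).ne', sub_add_sub_cancel]
      · funext i
        rw [Real.exp_log (by positivity), add_sub_cancel_left]
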